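/- Let $H$ be an infinite-dimensional complex Hilbert space, let $K$ be an arbitrary complex Hilbert space, and let $\psi : B(H) \to B(K)$ be a normal positive linear map; that is, $\psi$ is linear, $\psi(a)\ge 0$ whenever $a \ge 0$, and $\psi$ is continuous with respect to the ultraweak ($\sigma$-weak) topologies of $B(H)$ and $B(K)$. Then $\psi$ is Toeplitz completely positive: for every $n\in\mathbb N$ and all operators $\tau_{-n+1},\dots,\tau_{n-1}\in B(H)$ for which the Toeplitz matrix $[\tau_{k-j}]_{k,j=1}^n$ is a positive operator on $\bigoplus_1^n H$, the matrix $[\psi(\tau_{k-j})]_{k,j=1}^n$ is a positive operator on $\bigoplus_1^n K$. -/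

import Mathlib

/-- The ultraweak (`σ`-weak) topology on `B(H)`: the coarsest topology for which all functionals
`a ↦ ∑ₖ ⟪y k, a (x k)⟫`, with `∑ₖ ‖x k‖² < ∞` and `∑ₖ ‖y k‖² < ∞`, are continuous. -/
@[reducible] noncomputable def ultraweakTopology (H : Type*) [NormedAddCommGroup H] [InnerProductSpace ℂ H] :
    TopologicalSpace (H →L[ℂ] H) :=
  ⨅ (x : ℕ → H) (y : ℕ → H) (_ : Summable fun k => ‖x k‖ ^ 2) (_ : Summable fun k => ‖y k‖ ^ 2),
    TopologicalSpace.induced (fun a : H →L[ℂ] H => ∑' k, inner ℂ (y k) (a (x k))) inferInstance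

/-- A linear map `B(H) → B(K)` is normal if it is continuous for the ultraweak topologies. -/
def IsNormalMap {H K : Type*} [NormedAddCommGroup H] [InnerProductSpace ℂ H]
    [NormedAddCommGroup K] [InnerProductSpace ℂ K]
    (ψ : (H →L[ℂ] H) →ₗ[ℂ] (K →L[ℂ] K)) : Prop :=
  @Continuous _ _ (ultraweakTopology H) (ultraweakTopology K) ψ

/-- The operator on the Hilbert space direct sum of `n` copies of `H` that is given by an
`n × n` matrix of operators on `H`. -/
noncomputable def blockOperator {H : Type*} [NormedAddCommGroup H] [InnerProductSpace ℂ H]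
    {n : ℕ} (A : Matrix (Fin n) (Fin n) (H →L[ℂ] H)) :
    PiLp 2 (fun _ : Fin n => H) →L[ℂ] PiLp 2 (fun _ : Fin n => H) :=
  (PiLp.continuousLinearEquiv 2 ℂ (fun _ : Fin n => H)).symm.toContinuousLinearMap ∘L
    ContinuousLinearMap.pi fun i => ∑ j, A i j ∘L PiLp.proj 2 (fun _ : Fin n => H) j

theorem blockOperator_apply {H : Type*} [NormedAddCommGroup H] [InnerProductSpace ℂ H]
    {n : ℕ} (A : Matrix (Fin n) (Fin n) (H →L[ℂ] H)) (x : PiLp 2 (fun _ : Fin n => H))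
    (i : Fin n) : blockOperator A x i = ∑ j, A i j (x j) := by
  simp [blockOperator]

/-- The `n × n` Toeplitz matrix `[τ (k - j)]`, with row index `k` and column index `j`.
Only the values `τ ℓ` with `-n < ℓ < n` occur in it. -/
def toeplitzMatrix {R : Type*} (n : ℕ) (τ : ℤ → R) : Matrix (Fin n) (Fin n) R :=
  Matrix.of fun k j => τ ((k : ℤ) - (j : ℤ))

/-- A linear map `ψ : B(H) → B(K)` is Toeplitz completely positive if, for every `n`, its
entrywise application sends each positive `n × n` Toeplitz matrix over `B(H)` to a positive
matrix over `B(K)`. -/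
def IsToeplitzCompletelyPositive {H K : Type*} [NormedAddCommGroup H] [InnerProductSpace ℂ H]
    [NormedAddCommGroup K] [InnerProductSpace ℂ K]
    (ψ : (H →L[ℂ] H) →ₗ[ℂ] (K →L[ℂ] K)) : Prop :=
  ∀ (n : ℕ) (τ : ℤ → (H →L[ℂ] H)), (blockOperator (toeplitzMatrix n τ)).IsPositive →
    (blockOperator ((toeplitzMatrix n τ).map ψ)).IsPositive

/-! A positive Toeplitz matrix is a Gram matrix whose shift invariance makes the shift a contraction
`V`, so its entries are compressions `W* V^(-l) W`, negative powers meaning powers of `V*`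
(`exists_contraction_dilation`). For `|z| = 1`, `z • V` is again a contraction, so its Fejér sums
are positive (`isPositive_sum_intPower`). Hence `ψ` only has to be applied to single positive
operators. Pairing their images with `∑ z^(-a) x_a` and averaging over roots of unity isolates the
Toeplitz form of `ψ` with weights `N - |a - b|` (`fejer_toeplitz_form_nonneg`). Dividing by `N` and
letting `N → ∞` removes the weights. -/

/-- Douglas' factorization lemma: if `‖c x‖ ≤ ‖d x‖` for all `x`, then `c` factors through `d` by a
contraction. -/
theorem exists_contraction_comp_eq {G F F' : Type*} [AddCommGroup G] [Module ℂ G]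
    [NormedAddCommGroup F] [InnerProductSpace ℂ F] [CompleteSpace F]
    [NormedAddCommGroup F'] [InnerProductSpace ℂ F'] [CompleteSpace F']
    (c : G →ₗ[ℂ] F') (d : G →ₗ[ℂ] F) (h : ∀ x, ‖c x‖ ≤ ‖d x‖) :
    ∃ V : F →L[ℂ] F', ‖V‖ ≤ 1 ∧ ∀ x, V (d x) = c x := by
  set S : Submodule ℂ F := (LinearMap.range d).topologicalClosure with hS
  have : CompleteSpace S := (Submodule.isClosed_topologicalClosure _).completeSpace_coe
  have hmem : ∀ x, d x ∈ S := fun x =>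
    Submodule.le_topologicalClosure _ (LinearMap.mem_range_self d x)
  let e : G →ₗ[ℂ] S := d.codRestrict S hmem
  have hdense : DenseRange e := by
    intro y
    rw [closure_subtype]
    have hy : (y : F) ∈ closure (LinearMap.range d : Set F) := y.2
    refine closure_mono ?_ hy
    rintro _ ⟨x, rfl⟩
    exact ⟨e x, ⟨x, rfl⟩, rfl⟩
  have hnorm : ∀ x, ‖c x‖ ≤ 1 * ‖e x‖ := fun x => by simpa [e] using h x
  -- Extend continuously to the closure of the range of `d`, and by zero on its orthogonal
  -- complement.
  refine ⟨(c.extendOfNorm e).comp S.orthogonalProjectionOnto, ?_, fun x => ?_⟩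
  · refine (ContinuousLinearMap.opNorm_comp_le _ _).trans ?_
    exact mul_le_one₀ (LinearMap.opNorm_extendOfNorm_le hdense zero_le_one hnorm)
      (norm_nonneg _) S.orthogonalProjectionOnto_norm_le
  · have hx : S.orthogonalProjectionOnto (d x) = e x :=
      Submodule.orthogonalProjectionOnto_mem_subspace_eq_self (e x)
    rw [ContinuousLinearMap.comp_apply, hx]
    exact LinearMap.extendOfNorm_eq hdense ⟨1, hnorm⟩ x

/-! ### Fejér sums of a contraction -/

section IntPower

variable {E : Type*} [NormedAddCommGroup E] [InnerProductSpace ℂ E] [CompleteSpace E]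

/-- The power `U ^ m` for `m ≥ 0`, and the power `(U†) ^ (-m)` of the adjoint for `m < 0`. -/
noncomputable def intPower (U : E →L[ℂ] E) : ℤ → (E →L[ℂ] E)
  | .ofNat m => U ^ m
  | .negSucc m => star U ^ (m + 1)

@[simp] theorem intPower_natCast (U : E →L[ℂ] E) (m : ℕ) : intPower U m = U ^ m := rfl

@[simp] theorem intPower_neg_natCast (U : E →L[ℂ] E) (m : ℕ) :
    intPower U (-(m : ℤ)) = star U ^ m := by
  cases m with
  | zero => simp [intPower]
  | succ m => rfl

theorem star_intPower (U : E →L[ℂ] E) (m : ℤ) : star (intPower U m) = intPower U (-m) := by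
  obtain ⟨k, rfl | rfl⟩ := m.eq_nat_or_neg <;> simp

theorem intPower_smul (U : E →L[ℂ] E) {z : ℂ} (hz : ‖z‖ = 1) (m : ℤ) :
    intPower (z • U) m = z ^ m • intPower U m := by
  obtain ⟨k, rfl | rfl⟩ := m.eq_nat_or_neg
  · simp [smul_pow]
  · have : star z = z⁻¹ := (Complex.inv_eq_conj hz).symm
    simp [smul_pow, this]

/-- By induction: with `s` the partial sum, the next one is `U s + x`. Both sides gain `2 Re ⟪U s,
x⟫ + ‖x‖²`, and on the left `‖s‖²` becomes `‖U s‖² ≤ ‖s‖²`. -/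
theorem normSq_sum_pow_le (U : E →L[ℂ] E) (hU : ‖U‖ ≤ 1) (x : E) (N : ℕ) :
    ‖∑ i ∈ Finset.range N, (U ^ i) x‖ ^ 2 ≤
      Complex.re (inner ℂ x ((∑ j ∈ Finset.range N, ∑ k ∈ Finset.range N,
        intPower U ((j : ℤ) - k)) x)) := by
  induction N with
  | zero => simp
  | succ N ih =>
    set s := ∑ i ∈ Finset.range N, (U ^ i) x with hs
    have hstep : ∑ i ∈ Finset.range (N + 1), (U ^ i) x = U s + x := by
      rw [Finset.sum_range_succ', hs, map_sum]
      simp [pow_succ']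
    have hUs : ∑ k ∈ Finset.range N, intPower U ((N : ℤ) - k) x = U s := by
      rw [hs, map_sum, ← Finset.sum_range_reflect]
      refine Finset.sum_congr rfl fun k hk => ?_
      rw [Finset.mem_range] at hk
      have : ((N : ℤ) - ((N - 1 - k : ℕ) : ℤ)) = ((k + 1 : ℕ) : ℤ) := by omega
      rw [this, intPower_natCast, pow_succ']
      rfl
    have hUs' : ∑ j ∈ Finset.range N, inner ℂ x (intPower U ((j : ℤ) - N) x) = inner ℂ (U s) x := by
      rw [← hUs, sum_inner]
      refine Finset.sum_congr rfl fun j _ => ?_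
      rw [← neg_sub (N : ℤ) j, ← star_intPower, ContinuousLinearMap.star_eq_adjoint,
        ContinuousLinearMap.adjoint_inner_right]
    have hUn : ‖U s‖ ≤ ‖s‖ := by
      simpa using U.le_of_opNorm_le hU s
    have hre : Complex.re (inner ℂ x (U s)) = Complex.re (inner ℂ (U s) x) :=
      inner_re_symm (𝕜 := ℂ) x (U s)
    have hxx : Complex.re (inner ℂ x x) = ‖x‖ ^ 2 := inner_self_eq_norm_sq (𝕜 := ℂ) x
    have hadd : ‖U s + x‖ ^ 2 = ‖U s‖ ^ 2 + 2 * Complex.re (inner ℂ (U s) x) + ‖x‖ ^ 2 :=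
      norm_add_sq (𝕜 := ℂ) (U s) x
    have hexp : (∑ j ∈ Finset.range (N + 1), ∑ k ∈ Finset.range (N + 1),
        intPower U ((j : ℤ) - k)) x = (∑ j ∈ Finset.range N, ∑ k ∈ Finset.range N,
        intPower U ((j : ℤ) - k)) x + ∑ j ∈ Finset.range N, intPower U ((j : ℤ) - N) x
        + U s + x := by
      rw [← hUs, Finset.sum_range_succ, Finset.sum_range_succ]
      simp only [Finset.sum_range_succ _ N, Finset.sum_add_distrib, add_apply,
        sum_apply]
      have : intPower U ((N : ℤ) - N) x = x := by
        rw [sub_self]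
        exact congrArg (fun T : E →L[ℂ] E => T x) (pow_zero U)
      rw [this]
      abel
    rw [hstep, hexp, inner_add_right, inner_add_right, inner_add_right, inner_sum, hUs',
      Complex.add_re, Complex.add_re, Complex.add_re, hre, hxx, hadd]
    nlinarith [norm_nonneg (U s), norm_nonneg s]

/-- The unnormalized Fejér sums of a contraction are positive. -/
theorem isPositive_sum_intPower (U : E →L[ℂ] E) (hU : ‖U‖ ≤ 1) (N : ℕ) :
    (∑ j ∈ Finset.range N, ∑ k ∈ Finset.range N, intPower U ((j : ℤ) - k)).IsPositive := by
  rw [ContinuousLinearMap.isPositive_def']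
  refine ⟨?_, fun x => ?_⟩
  · rw [isSelfAdjoint_iff]
    simp only [star_sum, star_intPower, neg_sub]
    exact Finset.sum_comm
  · rw [ContinuousLinearMap.reApplyInnerSelf_apply, inner_re_symm]
    exact (sq_nonneg _).trans (normSq_sum_pow_le U hU x N)

end IntPower

theorem ContinuousLinearMap.IsPositive.exists_inner_map_map_eq {E : Type*} [NormedAddCommGroup E]
    [InnerProductSpace ℂ E] [CompleteSpace E] {A : E →L[ℂ] E} (hA : A.IsPositive) :
    ∃ B : E →L[ℂ] E, ∀ x y, inner ℂ (B x) (B y) = inner ℂ x (A y) := by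
  obtain ⟨B, rfl⟩ := CStarAlgebra.nonneg_iff_eq_star_mul_self.1
    ((ContinuousLinearMap.nonneg_iff_isPositive A).2 hA)
  refine ⟨B, fun x y => ?_⟩
  rw [ContinuousLinearMap.star_eq_adjoint]
  exact (ContinuousLinearMap.adjoint_inner_right B x (B y)).symm

theorem toeplitzMatrix_apply {R : Type*} (n : ℕ) (τ : ℤ → R) (k j : Fin n) :
    toeplitzMatrix n τ k j = τ ((k : ℤ) - j) := rfl

/-! ### Dilation of a positive Toeplitz matrix -/

section Dilation

variable {H : Type*} [NormedAddCommGroup H] [InnerProductSpace ℂ H]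

theorem inner_blockOperator {n : ℕ} (A : Matrix (Fin n) (Fin n) (H →L[ℂ] H))
    (x y : PiLp 2 (fun _ : Fin n => H)) :
    inner ℂ x (blockOperator A y) = ∑ i, ∑ j, inner ℂ (x i) (A i j (y j)) := by
  simp only [PiLp.inner_apply, blockOperator_apply, inner_sum]

theorem inner_single_blockOperator_single {n : ℕ} (A : Matrix (Fin n) (Fin n) (H →L[ℂ] H))
    (i j : Fin n) (g h : H) :
    inner ℂ (PiLp.single 2 i g : PiLp 2 (fun _ : Fin n => H))
      (blockOperator A (PiLp.single 2 j h)) = inner ℂ g (A i j h) := by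
  rw [inner_blockOperator, Finset.sum_eq_single i, Finset.sum_eq_single j]
  · simp
  · intro b _ hb
    simp [hb]
  · simp
  · intro b _ hb
    simp [hb]
  · simp

/-- Prepend a zero to a vector of `H ^ m`. -/
noncomputable def consZero (H : Type*) [NormedAddCommGroup H] [InnerProductSpace ℂ H] (m : ℕ) :
    (Fin m → H) →ₗ[ℂ] PiLp 2 (fun _ : Fin (m + 1) => H) where
  toFun g := WithLp.toLp 2 (Fin.cons (α := fun _ => H) 0 g)
  map_add' f g := by
    ext i
    refine Fin.cases ?_ (fun i => ?_) i <;> simp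
  map_smul' c g := by
    ext i
    refine Fin.cases ?_ (fun i => ?_) i <;> simp

/-- Append a zero to a vector of `H ^ m`. -/
noncomputable def snocZero (H : Type*) [NormedAddCommGroup H] [InnerProductSpace ℂ H] (m : ℕ) :
    (Fin m → H) →ₗ[ℂ] PiLp 2 (fun _ : Fin (m + 1) => H) where
  toFun g := WithLp.toLp 2 (Fin.snoc (α := fun _ => H) g 0)
  map_add' f g := by
    ext i
    refine Fin.lastCases ?_ (fun i => ?_) i <;> simp
  map_smul' c g := by
    ext i
    refine Fin.lastCases ?_ (fun i => ?_) i <;> simp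

@[simp] theorem consZero_apply_zero {m : ℕ} (g : Fin m → H) : consZero H m g 0 = 0 := rfl

@[simp] theorem consZero_apply_succ {m : ℕ} (g : Fin m → H) (i : Fin m) :
    consZero H m g i.succ = g i := rfl

@[simp] theorem snocZero_apply_last {m : ℕ} (g : Fin m → H) :
    snocZero H m g (Fin.last m) = 0 := by
  simp [snocZero]

@[simp] theorem snocZero_apply_castSucc {m : ℕ} (g : Fin m → H) (i : Fin m) :
    snocZero H m g i.castSucc = g i := by
  simp [snocZero]

theorem consZero_single {m : ℕ} (k : Fin m) (h : H) :
    consZero H m (Pi.single k h) = PiLp.single 2 k.succ h := by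
  ext i
  refine Fin.cases ?_ (fun i => ?_) i
  · simp [(Fin.succ_ne_zero k).symm]
  · by_cases hik : i = k
    · subst hik; simp
    · simp [hik]

theorem snocZero_single {m : ℕ} (k : Fin m) (h : H) :
    snocZero H m (Pi.single k h) = PiLp.single 2 k.castSucc h := by
  ext i
  refine Fin.lastCases ?_ (fun i => ?_) i
  · simp [(Fin.castSucc_lt_last k).ne']
  · by_cases hik : i = k
    · subst hik; simp
    · simp [hik]

/-- The quadratic form of a Toeplitz matrix is invariant under the shift. -/
theorem inner_toeplitz_consZero {m : ℕ} (τ : ℤ → (H →L[ℂ] H)) (g : Fin m → H) :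
    inner ℂ (consZero H m g) (blockOperator (toeplitzMatrix (m + 1) τ) (consZero H m g)) =
      inner ℂ (snocZero H m g) (blockOperator (toeplitzMatrix (m + 1) τ) (snocZero H m g)) := by
  simp only [inner_blockOperator, toeplitzMatrix_apply]
  trans ∑ i : Fin m, ∑ j : Fin m, inner ℂ (g i) (τ ((i : ℤ) - j) (g j))
  · rw [Fin.sum_univ_succ]
    simp [Fin.sum_univ_succ (n := m)]
  · rw [Fin.sum_univ_castSucc]
    simp [Fin.sum_univ_castSucc (n := m)]

variable [CompleteSpace H]

/-- A positive Toeplitz matrix of operators is a compression of the powers of a contraction. -/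
theorem exists_contraction_dilation {m : ℕ} (τ : ℤ → (H →L[ℂ] H))
    (hτ : (blockOperator (toeplitzMatrix (m + 1) τ)).IsPositive) :
    ∃ (V : PiLp 2 (fun _ : Fin (m + 1) => H) →L[ℂ] PiLp 2 (fun _ : Fin (m + 1) => H))
      (W : H →L[ℂ] PiLp 2 (fun _ : Fin (m + 1) => H)), ‖V‖ ≤ 1 ∧
      ∀ l : ℤ, |l| ≤ m →
        (ContinuousLinearMap.adjoint W).comp ((intPower V (-l)).comp W) = τ l := by
  obtain ⟨B, hinner⟩ := hτ.exists_inner_map_map_eq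
  obtain ⟨V, hV, hVB⟩ := exists_contraction_comp_eq (B.toLinearMap ∘ₗ consZero H m)
    (B.toLinearMap ∘ₗ snocZero H m) (fun g => by
      refine le_of_eq ?_
      simp only [LinearMap.comp_apply, ContinuousLinearMap.coe_coe]
      rw [@norm_eq_sqrt_re_inner ℂ, @norm_eq_sqrt_re_inner ℂ, hinner, hinner,
        inner_toeplitz_consZero])
  obtain ⟨W, hW⟩ : ∃ W : H →L[ℂ] PiLp 2 (fun _ : Fin (m + 1) => H),
      ∀ h, W h = B (PiLp.single 2 0 h) :=
    ⟨B.comp ((PiLp.continuousLinearEquiv 2 ℂ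
      (fun _ : Fin (m + 1) => H)).symm.toContinuousLinearMap.comp
        (ContinuousLinearMap.single ℂ (fun _ : Fin (m + 1) => H) 0)), fun _ => rfl⟩
  -- `V` moves each `B`-image one coordinate up, so the orbit of `W h` runs through all the Gram
  -- vectors.
  have hpow : ∀ (k : Fin (m + 1)) (h : H), (V ^ (k : ℕ)) (W h) = B (PiLp.single 2 k h) := by
    intro k h
    induction k using Fin.induction with
    | zero => simp [hW]
    | succ i ih =>
      have := hVB (Pi.single i h)
      simp only [LinearMap.comp_apply, ContinuousLinearMap.coe_coe, snocZero_single,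
        consZero_single] at this
      rw [← this, ← ih, Fin.val_succ, pow_succ']
      rfl
  refine ⟨V, W, hV, fun l hl => ?_⟩
  ext h
  refine ext_inner_left ℂ fun g => ?_
  rw [ContinuousLinearMap.comp_apply, ContinuousLinearMap.adjoint_inner_right,
    ContinuousLinearMap.comp_apply]
  obtain ⟨k, rfl | rfl⟩ := l.eq_nat_or_neg
  · have hk : k < m + 1 := by
      rw [Nat.abs_cast] at hl
      omega
    rw [intPower_neg_natCast, ← star_pow, ContinuousLinearMap.star_eq_adjoint,
      ContinuousLinearMap.adjoint_inner_right, hpow ⟨k, hk⟩ g, hW, hinner,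
      inner_single_blockOperator_single]
    simp [toeplitzMatrix_apply]
  · have hk : k < m + 1 := by
      rw [abs_neg, Nat.abs_cast] at hl
      omega
    rw [neg_neg, intPower_natCast, hpow ⟨k, hk⟩ h, hW, hinner, inner_single_blockOperator_single]
    simp [toeplitzMatrix_apply]

end Dilation

/-! ### Averaging over roots of unity -/

theorem IsPrimitiveRoot.sum_pow_zpow {M : ℕ} {ζ : ℂ} (hζ : IsPrimitiveRoot ζ M) {l : ℤ}
    (hl : |l| < M) :
    ∑ i ∈ Finset.range M, (ζ ^ i) ^ l = if l = 0 then (M : ℂ) else 0 := by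
  split_ifs with h
  · simp [h]
  · have hne : ζ ^ l ≠ 1 := fun h1 =>
      h (Int.eq_zero_of_abs_lt_dvd ((hζ.zpow_eq_one_iff_dvd l).1 h1) hl)
    have hcomm : ∀ i : ℕ, (ζ ^ i) ^ l = (ζ ^ l) ^ i := fun i => by
      rw [← zpow_natCast, ← zpow_natCast, zpow_comm]
    have hone : (ζ ^ l) ^ M = 1 := by rw [← hcomm, hζ.pow_eq_one, one_zpow]
    simp only [hcomm]
    rw [geom_sum_eq hne, hone, sub_self, zero_div]

/-- Counts the pairs on one diagonal of an `N × N` square; this is the source of the Fejér weight.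
-/
theorem sum_range_ite_sub_eq (N : ℕ) (m : ℤ) (hm : |m| ≤ N) :
    ∑ j ∈ Finset.range N, ∑ k ∈ Finset.range N, (if (j : ℤ) - k = m then (1 : ℂ) else 0) =
      N - |m| := by
  wlog h : 0 ≤ m generalizing m
  · have := this (-m) (by simpa using hm) (by omega)
    rw [Finset.sum_comm, abs_neg] at this
    rw [← this]
    refine Finset.sum_congr rfl fun j _ => Finset.sum_congr rfl fun k _ => ?_
    congr 1
    exact propext ⟨fun h => by omega, fun h => by omega⟩
  obtain ⟨m, rfl⟩ := Int.eq_ofNat_of_zero_le h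
  have hmN : m ≤ N := by simpa using hm
  have inner_sum : ∀ j ∈ Finset.range N,
      ∑ k ∈ Finset.range N, (if (j : ℤ) - k = m then (1 : ℂ) else 0) = if m ≤ j then 1 else 0 := by
    intro j hj
    rw [Finset.mem_range] at hj
    split_ifs with hmj
    · rw [Finset.sum_eq_single_of_mem (j - m) (Finset.mem_range.2 (by omega))]
      · rw [if_pos (by omega)]
      · intro k _ hk
        rw [if_neg (by omega)]
    · exact Finset.sum_eq_zero fun k _ => if_neg (by omega)
  rw [Finset.sum_congr rfl inner_sum, Finset.sum_boole]
  have : (Finset.range N).filter (fun j => m ≤ j) = Finset.Ico m N := by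
    ext j; simp; omega
  rw [this, Nat.card_Ico, Nat.cast_sub hmN]
  simp

open scoped ComplexOrder in
theorem Complex.nonneg_of_natCast_mul_nonneg {N : ℕ} (hN : 0 < N) {z : ℂ} (h : 0 ≤ (N : ℂ) * z) :
    0 ≤ z := by
  have hN' : (0 : ℝ) < N := by exact_mod_cast hN
  rw [Complex.nonneg_iff] at h ⊢
  simpa [hN', hN.ne', eq_comm] using h

open scoped ComplexOrder in
/-- A positive map `ψ`, applied entrywise to the Toeplitz matrix of the compressed powers of a
contraction with Fejér weights, gives a positive matrix. -/
theorem fejer_toeplitz_form_nonneg {H : Type*} [NormedAddCommGroup H] [InnerProductSpace ℂ H]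
    [CompleteSpace H] {K : Type*} [NormedAddCommGroup K] [InnerProductSpace ℂ K]
    {E : Type*} [NormedAddCommGroup E] [InnerProductSpace ℂ E] [CompleteSpace E]
    (ψ : (H →L[ℂ] H) →ₗ[ℂ] (K →L[ℂ] K))
    (hpos : ∀ a : H →L[ℂ] H, a.IsPositive → (ψ a).IsPositive)
    (V : E →L[ℂ] E) (hV : ‖V‖ ≤ 1) (W : H →L[ℂ] E) {n : ℕ} (x : Fin n → K) (N : ℕ) (hN : n ≤ N) :
    0 ≤ ∑ a : Fin n, ∑ b : Fin n, ((N : ℂ) - |(a : ℤ) - b|) *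
      inner ℂ (x a) (ψ ((ContinuousLinearMap.adjoint W).comp
        ((intPower V (-((a : ℤ) - b))).comp W)) (x b)) := by
  let T : ℤ → (H →L[ℂ] H) := fun l =>
    (ContinuousLinearMap.adjoint W).comp ((intPower V l).comp W)
  -- The exponents `(j - k) + (a - b)` stay below `M` in absolute value, so averaging over `M`-th
  -- roots of unity keeps only exponent zero.
  set M : ℕ := N + n + 1 with hM
  have hM0 : M ≠ 0 := by omega
  set ζ : ℂ := Complex.exp (2 * Real.pi * Complex.I / M)
  have hζ : IsPrimitiveRoot ζ M := Complex.isPrimitiveRoot_exp M hM0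
  have hnorm : ∀ i : ℕ, ‖ζ ^ i‖ = 1 := fun i => by
    rw [norm_pow, hζ.norm'_eq_one hM0, one_pow]
  let P : ℂ → (H →L[ℂ] H) := fun z => ∑ j ∈ Finset.range N, ∑ k ∈ Finset.range N,
    z ^ ((j : ℤ) - k) • T ((j : ℤ) - k)
  have hP : ∀ z : ℂ, ‖z‖ = 1 → (P z).IsPositive := by
    intro z hz
    have h1 := (isPositive_sum_intPower (z • V) (by rwa [norm_smul, hz, one_mul]) N).adjoint_conj W
    convert h1 using 1
    simp only [P, T, intPower_smul V hz]
    ext h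
    simp [sum_apply, map_sum]
  -- The twist gives the `(a, b)` term the factor `z^(a - b)`, so the average selects `j - k = -(a -
  -- b)`.
  let y : ℂ → K := fun z => ∑ a : Fin n, z ^ (-(a : ℤ)) • x a
  have hy : ∀ z : ℂ, ‖z‖ = 1 → inner ℂ (y z) (ψ (P z) (y z)) =
      ∑ a : Fin n, ∑ b : Fin n, ∑ j ∈ Finset.range N, ∑ k ∈ Finset.range N,
        z ^ (((j : ℤ) - k) + ((a : ℤ) - b)) * inner ℂ (x a) (ψ (T ((j : ℤ) - k)) (x b)) := by
    intro z hz
    have hz0 : z ≠ 0 := by rintro rfl; simp at hz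
    have hconj : ∀ a : ℤ, (starRingEnd ℂ) (z ^ (-a)) = z ^ a := fun a => by
      rw [map_zpow₀, ← Complex.inv_eq_conj hz, inv_zpow', neg_neg]
    have hquad : ∀ A : K →L[ℂ] K, inner ℂ (y z) (A (y z)) =
        ∑ a : Fin n, ∑ b : Fin n, z ^ (a : ℤ) * (z ^ (-(b : ℤ)) * inner ℂ (x a) (A (x b))) := by
      intro A
      simp only [y, sum_inner, map_sum, inner_sum, map_smul, inner_smul_left, inner_smul_right,
        hconj, Finset.mul_sum]
      rw [Finset.sum_comm]
      exact Finset.sum_congr rfl fun a _ => Finset.sum_congr rfl fun b _ => by ring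
    rw [hquad]
    refine Finset.sum_congr rfl fun a _ => Finset.sum_congr rfl fun b _ => ?_
    simp only [P, map_sum, map_smul, sum_apply, smul_apply, inner_sum, inner_smul_right,
      Finset.mul_sum]
    refine Finset.sum_congr rfl fun j _ => Finset.sum_congr rfl fun k _ => ?_
    rw [sub_eq_add_neg (a : ℤ), zpow_add₀ hz0 ((j : ℤ) - k), zpow_add₀ hz0 (a : ℤ)]
    ring
  have hsum : ∑ i ∈ Finset.range M, inner ℂ (y (ζ ^ i)) (ψ (P (ζ ^ i)) (y (ζ ^ i))) =
      (M : ℂ) * ∑ a : Fin n, ∑ b : Fin n, ((N : ℂ) - |(a : ℤ) - b|) *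
        inner ℂ (x a) (ψ (T (-((a : ℤ) - b))) (x b)) := by
    simp only [hy _ (hnorm _)]
    rw [Finset.sum_comm, Finset.mul_sum]
    refine Finset.sum_congr rfl fun a _ => ?_
    rw [Finset.sum_comm, Finset.mul_sum]
    refine Finset.sum_congr rfl fun b _ => ?_
    have hab : |-((a : ℤ) - b)| ≤ N := by
      rw [abs_le]
      omega
    have hcount := sum_range_ite_sub_eq N (-((a : ℤ) - b)) hab
    rw [abs_neg] at hcount
    rw [← hcount, Finset.sum_comm, ← mul_assoc, Finset.mul_sum, Finset.sum_mul]
    refine Finset.sum_congr rfl fun j hj => ?_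
    rw [Finset.sum_comm, Finset.mul_sum, Finset.sum_mul]
    refine Finset.sum_congr rfl fun k hk => ?_
    rw [Finset.mem_range] at hj hk
    rw [← Finset.sum_mul, hζ.sum_pow_zpow (by rw [abs_lt]; omega)]
    by_cases h : (j : ℤ) - k = -((a : ℤ) - b)
    · rw [if_pos h, if_pos (by omega), h, mul_one]
    · rw [if_neg h, if_neg (by omega)]
      simp
  have hnn : 0 ≤ (M : ℂ) * ∑ a : Fin n, ∑ b : Fin n, ((N : ℂ) - |(a : ℤ) - b|) *
        inner ℂ (x a) (ψ (T (-((a : ℤ) - b))) (x b)) := by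
    rw [← hsum]
    exact Finset.sum_nonneg fun i _ => (hpos _ (hP _ (hnorm i))).inner_nonneg_right _
  exact Complex.nonneg_of_natCast_mul_nonneg (Nat.pos_of_ne_zero hM0) hnn

/-! ### Passage to the limit -/

open scoped ComplexOrder in
theorem mainTheorem4 {H : Type*} [NormedAddCommGroup H] [InnerProductSpace ℂ H] [CompleteSpace H]
    (hH : ¬ FiniteDimensional ℂ H)
    {K : Type*} [NormedAddCommGroup K] [InnerProductSpace ℂ K] [CompleteSpace K]
    (ψ : (H →L[ℂ] H) →ₗ[ℂ] (K →L[ℂ] K))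
    (hpos : ∀ a : H →L[ℂ] H, a.IsPositive → (ψ a).IsPositive)
    (hnormal : IsNormalMap ψ) :
    IsToeplitzCompletelyPositive ψ := by
  intro n τ hτ
  rcases n with _ | m
  · rw [Subsingleton.elim (blockOperator _) 0]
    exact ContinuousLinearMap.isPositive_zero
  obtain ⟨V, W, hV, hVW⟩ := exists_contraction_dilation τ hτ
  -- Nonnegativity in the order of `ℂ` includes realness, so it also yields symmetry.
  suffices h : ∀ x, 0 ≤ inner ℂ x (blockOperator ((toeplitzMatrix (m + 1) τ).map ψ) x) by
    rw [ContinuousLinearMap.isPositive_iff_complex]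
    intro x
    obtain ⟨hre, him⟩ := Complex.nonneg_iff.1 (h x)
    have hxx := inner_conj_symm (𝕜 := ℂ) (blockOperator ((toeplitzMatrix (m + 1) τ).map ψ) x) x
    rw [Complex.conj_eq_iff_im.2 him.symm] at hxx
    rw [← hxx]
    exact ⟨Complex.ext rfl him, hre⟩
  intro x
  -- The weights are `(N - |a - b|) / N`; the finite sum allows termwise limits.
  have hlim : Filter.Tendsto (fun N : ℕ => ∑ a : Fin (m + 1), ∑ b : Fin (m + 1),
      (1 - ((|(a : ℤ) - b| : ℤ) : ℂ) / N) * inner ℂ (x a) (ψ (τ ((a : ℤ) - b)) (x b)))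
      Filter.atTop (nhds (∑ a : Fin (m + 1), ∑ b : Fin (m + 1),
      (1 - 0) * inner ℂ (x a) (ψ (τ ((a : ℤ) - b)) (x b)))) := by
    refine tendsto_finsetSum _ fun a _ => tendsto_finsetSum _ fun b _ => ?_
    exact ((tendsto_const_div_atTop_nhds_zero_nat _).const_sub 1).mul_const _
  have hval : inner ℂ x (blockOperator ((toeplitzMatrix (m + 1) τ).map ψ) x) =
      ∑ a : Fin (m + 1), ∑ b : Fin (m + 1),
      (1 - 0) * inner ℂ (x a) (ψ (τ ((a : ℤ) - b)) (x b)) := by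
    simp [inner_blockOperator, toeplitzMatrix_apply]
  rw [hval]
  refine ge_of_tendsto hlim ?_
  filter_upwards [Filter.eventually_ge_atTop (m + 1)] with N hN
  have hN0 : 0 < N := (Nat.succ_pos m).trans_le hN
  refine Complex.nonneg_of_natCast_mul_nonneg hN0 ?_
  refine (fejer_toeplitz_form_nonneg ψ hpos V hV W (fun a => x a) N hN).trans_eq ?_
  rw [Finset.mul_sum]
  refine Finset.sum_congr rfl fun a _ => ?_
  rw [Finset.mul_sum]
  refine Finset.sum_congr rfl fun b _ => ?_
  rw [hVW _ (by rw [abs_le]; omega), ← mul_assoc, mul_sub, mul_one,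
    mul_div_cancel₀ _ (Nat.cast_ne_zero.2 hN0.ne')]
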